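/- Let $n\ge 2$. A convex body is a nonempty compact convex subset of $\mathbb R^n$; write $h_K(a)=\max_{x\in K}a^Tx$ for the support function of a convex body $K$. For convex bodies $K,L$ put $$R(K,L)=\inf\{\rho\ge 0:\ K\subset t+\rho L\ \text{for some } t\in\mathbb R^n\}.$$ Let $C\subset\mathbb R^n$ be a convex body with $0\in\operatorname{int}C$, let $s(C)=R(C,-C)$ be its Minkowski asymmetry, and assume that $C$ is Minkowski-centered, i.e. $C\subset -s(C)\,C$ and $R(C,-s(C)C)=1$. For a convex body $K$ let $$D(K)=D_{\mathrm{MAX}}(K,C)=\max_{a\in\mathbb R^n\setminus\{0\}}\frac{h_K(a)+h_K(-a)}{\max(h_C(a),h_C(-a))}$$ be its maximum diameter. A convex body $K$ is complete if $D(K')>D(K)$ for every convex body $K'\supsetneq K$, and a completion of $K$ is a complete convex body $K^*\supset K$ with $D(K^*)=D(K)$. Let $C_{\mathrm{MAX}}=\operatorname{conv}(C\cup -C)$, let $$C^{\sup}=\bigcap_{x\in C}\bigl(x+D(C)\,C_{\mathrm{MAX}}\bigr),$$ let $C^\circ=\{a\in\mathbb R^n: h_C(a)\le 1\}$ be the polar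 of $C$, and let $$C^{\mathrm{out}}=\bigcap_{a\in \operatorname{bd}(C^\circ)\cap\operatorname{bd}(-C^\circ)}\{x\in\mathbb R^n: a^Tx\le 1\}.$$ Then: (i) $C_{\mathrm{MAX}}$ is a completion of $C$, $R(C_{\mathrm{MAX}},C)=s(C)$, and $R(K,C)\le R(C_{\mathrm{MAX}},C)$ for every completion $K$ of $C$; (ii) $C_{\mathrm{MAX}}\subset C^{\sup}\subset C^{\mathrm{out}}$; (iii) $C_{\mathrm{MAX}}=C^{\sup}$ if and only if $C_{\mathrm{MAX}}=C^{\mathrm{out}}$; (iv) $C_{\mathrm{MAX}}$ is $0$-symmetric (i.e. equal to its reflection $-C_{\mathrm{MAX}}$), and it is the only $0$-symmetric completion of $C$. -/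

import Mathlib

open scoped Pointwise

noncomputable section

namespace GaugeGeometry

variable {n : ℕ}

/-- The support function `h_A(a) = max_{x ∈ A} aᵀx` (a maximum whenever `A` is nonempty and
compact). -/
def supportFun (A : Set (EuclideanSpace ℝ (Fin n))) (a : EuclideanSpace ℝ (Fin n)) : ℝ :=
  sSup ((fun x => inner ℝ a x) '' A)

/-- The polar `{a : h_C(a) ≤ 1}`. -/
def polarBody (C : Set (EuclideanSpace ℝ (Fin n))) : Set (EuclideanSpace ℝ (Fin n)) :=
  {a | supportFun C a ≤ 1}

/-- The circumradius `R(K, C) = inf {ρ ≥ 0 : K ⊆ t + ρ C for some t}`. It is used only for bounded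
`K` and for `C` with nonempty interior, where the set of such `ρ` is nonempty. -/
def circumradius (K C : Set (EuclideanSpace ℝ (Fin n))) : ℝ :=
  sInf {ρ : ℝ | 0 ≤ ρ ∧ ∃ t : EuclideanSpace ℝ (Fin n), K ⊆ t +ᵥ ρ • C}

/-- `K` is optimally contained in `C`. -/
def OptContained (K C : Set (EuclideanSpace ℝ (Fin n))) : Prop :=
  K ⊆ C ∧ circumradius K C = 1

/-- The Minkowski asymmetry `s(C) = R(C, -C)`. -/
def asymmetry (C : Set (EuclideanSpace ℝ (Fin n))) : ℝ :=
  circumradius C (-C)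

/-- `C` is Minkowski-centered: it is optimally contained in `-s(C) C`. -/
def IsMinkowskiCentered (C : Set (EuclideanSpace ℝ (Fin n))) : Prop :=
  OptContained C ((-asymmetry C) • C)

/-- The breadth of `K` in direction `s` belonging to the maximum diameter. -/
def breadthMax (K C : Set (EuclideanSpace ℝ (Fin n))) (s : EuclideanSpace ℝ (Fin n)) : ℝ :=
  (supportFun K s + supportFun K (-s)) / max (supportFun C s) (supportFun C (-s))

/-- The maximum diameter `D_MAX(K, C)`: the largest breadth over all directions `s ≠ 0`. -/
def diamMax (K C : Set (EuclideanSpace ℝ (Fin n))) : ℝ :=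
  sSup (breadthMax K C '' {s | s ≠ 0})

/-- The maximum symmetrization `C_MAX = conv (C ∪ -C)` of a convex body. -/
def symMax (C : ConvexBody (EuclideanSpace ℝ (Fin n))) :
    ConvexBody (EuclideanSpace ℝ (Fin n)) where
  carrier := convexHull ℝ ((C : Set (EuclideanSpace ℝ (Fin n))) ∪ -(C : Set _))
  convex' := convex_convexHull ℝ _
  isCompact' := by
    have hC : IsCompact (C : Set (EuclideanSpace ℝ (Fin n))) := C.isCompact
    rw [C.convex.convexHull_union C.convex.neg C.nonempty C.nonempty.neg]
    have h : IsCompact ((fun p : ℝ × (EuclideanSpace ℝ (Fin n)) × (EuclideanSpace ℝ (Fin n)) =>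
        AffineMap.lineMap p.2.1 p.2.2 p.1) ''
          (Set.Icc (0 : ℝ) 1 ×ˢ ((C : Set (EuclideanSpace ℝ (Fin n))) ×ˢ (-(C : Set _))))) := by
      refine (isCompact_Icc.prod (hC.prod hC.neg)).image ?_
      simp only [AffineMap.lineMap_apply_module]
      fun_prop
    convert h using 1
    ext x
    simp only [mem_convexJoin, segment_eq_image_lineMap, Set.mem_image, Set.mem_prod, Prod.exists]
    constructor
    · rintro ⟨a, ha, b, hb, θ, hθ, rfl⟩
      exact ⟨θ, a, b, ⟨hθ, ha, hb⟩, rfl⟩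
    · rintro ⟨θ, a, b, ⟨hθ, ha, hb⟩, rfl⟩
      exact ⟨a, ha, b, hb, θ, hθ, rfl⟩
  nonempty' := (C.nonempty.mono Set.subset_union_left).convexHull

/-- `K` is complete with respect to `D_MAX(·, C)`: every strictly larger convex body has strictly
larger diameter. -/
def IsDiamComplete (C K : ConvexBody (EuclideanSpace ℝ (Fin n))) : Prop :=
  ∀ K' : ConvexBody (EuclideanSpace ℝ (Fin n)),
    (K : Set (EuclideanSpace ℝ (Fin n))) ⊂ K' →
      diamMax (K : Set (EuclideanSpace ℝ (Fin n))) C < diamMax (K' : Set (EuclideanSpace ℝ (Fin n))) C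

/-- `K'` is a completion of `K` with respect to `D_MAX(·, C)`. -/
def IsCompletion (C K K' : ConvexBody (EuclideanSpace ℝ (Fin n))) : Prop :=
  (K : Set (EuclideanSpace ℝ (Fin n))) ⊆ K' ∧ IsDiamComplete C K' ∧
    diamMax (K' : Set (EuclideanSpace ℝ (Fin n))) C = diamMax (K : Set (EuclideanSpace ℝ (Fin n))) C

/-- The supercompletion `K^sup = ⋂_{x ∈ K} (x + D_MAX(K, C) C_MAX)`. -/
def supercompletion (C K : ConvexBody (EuclideanSpace ℝ (Fin n))) :
    Set (EuclideanSpace ℝ (Fin n)) :=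
  ⋂ x ∈ (K : Set (EuclideanSpace ℝ (Fin n))),
    x +ᵥ diamMax (K : Set (EuclideanSpace ℝ (Fin n))) C •
      (symMax C : Set (EuclideanSpace ℝ (Fin n)))

/-- The outer symmetric support `C^out = ⋂_{a ∈ bd C° ∩ bd (-C°)} {x : aᵀx ≤ 1}`. -/
def outerSupport (C : Set (EuclideanSpace ℝ (Fin n))) : Set (EuclideanSpace ℝ (Fin n)) :=
  ⋂ a ∈ frontier (polarBody C) ∩ frontier (-polarBody C), {x | inner ℝ a x ≤ 1}

end GaugeGeometry

end

open GaugeGeometry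

open scoped Pointwise

namespace GaugeGeometry

variable {n : ℕ}

/-! ### Compactness of the convex hull of a compact set. -/

section ConvexHull

variable {S T : Set (EuclideanSpace ℝ (Fin n))}

/-! Write `h` for the support function of `C` and `M` for `C_MAX`, so that `h_M(a) = max (h a) (h
(-a))`. Since `n ≥ 2`, some `a ≠ 0` has `h a = h (-a)`; hence every body between `C` and `M` has
diameter exactly 2. Adding a point to `M` raises its breadth above 2 in a separating direction, so
`M` is complete; a symmetric completion contains `M`, hence equals it.

Everything about `C^sup` follows from its description by `⟪a, x⟫ ≤ f a` for all `a`, where `f a = 2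
h_M(a) - h(-a) ≥ h_M(a)` (`mem_supercompletion_iff`). It contains every completion; directions with
`h a = h (-a) = 1` give `C^sup ⊆ C^out`; and `h a ≤ s h (-a)` gives `C^sup ⊆ s C`, hence the bounds
on circumradii.

For (iii), `f` need not be convex, but if `C^sup = M` then duality makes the polar of `M` the convex
hull of `{f ≤ 1}`. Its extreme points then satisfy `f ≤ 1`, and by symmetry so do their negatives,
which forces `h e = h (-e) = 1`. By Krein–Milman these directions already cut out `M`, so `C^out ⊆
M`. -/

theorem isCompact_convexJoin (hS : IsCompact S) (hT : IsCompact T) :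
    IsCompact (convexJoin ℝ S T) := by
  have h : convexJoin ℝ S T =
      (fun p : ℝ × (EuclideanSpace ℝ (Fin n)) × (EuclideanSpace ℝ (Fin n)) =>
        AffineMap.lineMap p.2.1 p.2.2 p.1) '' (Set.Icc (0 : ℝ) 1 ×ˢ (S ×ˢ T)) := by
    ext x
    simp only [mem_convexJoin, segment_eq_image_lineMap, Set.mem_image, Set.mem_prod, Prod.exists]
    constructor
    · rintro ⟨a, ha, b, hb, θ, hθ, rfl⟩
      exact ⟨θ, a, b, ⟨hθ, ha, hb⟩, rfl⟩
    · rintro ⟨θ, a, b, ⟨hθ, ha, hb⟩, rfl⟩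
      exact ⟨a, ha, b, hb, θ, hθ, rfl⟩
  rw [h]
  refine (isCompact_Icc.prod (hS.prod hT)).image ?_
  simp only [AffineMap.lineMap_apply_module]
  fun_prop

/-- Induction on the number of points: the hull of `insert a u` is the join of `{a}` with the hull
of `u`, and joins preserve compactness. -/
theorem exists_isCompact_convexHull_finset_subset (hS : IsCompact S) (k : ℕ) :
    ∃ T ⊆ convexHull ℝ S, IsCompact T ∧
      ∀ t : Finset (EuclideanSpace ℝ (Fin n)), ↑t ⊆ S → t.card ≤ k → convexHull ℝ ↑t ⊆ T := by
  induction k with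
  | zero =>
    refine ⟨∅, Set.empty_subset _, isCompact_empty, fun t _ ht => ?_⟩
    simp [Finset.card_eq_zero.1 (Nat.le_zero.1 ht)]
  | succ k ih =>
    obtain ⟨T, hTS, hT, h⟩ := ih
    refine ⟨S ∪ convexJoin ℝ S T, Set.union_subset (subset_convexHull ℝ S) ?_,
      hS.union (isCompact_convexJoin hS hT), fun t ht hk => ?_⟩
    · exact (convexJoin_mono (subset_convexHull ℝ S) hTS).trans
        (convexJoin_subset subset_rfl subset_rfl (convex_convexHull ℝ S))
    · classical
      induction t using Finset.induction_on with
      | empty => simp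
      | insert a u hau _ =>
        rw [Finset.card_insert_of_notMem hau] at hk
        rw [Finset.coe_insert, Set.insert_subset_iff] at ht
        rcases u.eq_empty_or_nonempty with rfl | hu
        · simpa using Or.inl ht.1
        rw [Finset.coe_insert, convexHull_insert (by simpa using hu)]
        exact (convexJoin_mono (Set.singleton_subset_iff.2 ht.1)
          (h u ht.2 (by omega))).trans Set.subset_union_right

theorem isCompact_convexHull (hS : IsCompact S) : IsCompact (convexHull ℝ S) := by
  -- Carathéodory: affinely independent subsets have at most `n + 1` points.
  obtain ⟨T, hTS, hT, h⟩ := exists_isCompact_convexHull_finset_subset hS (n + 1)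
  convert hT
  refine Set.Subset.antisymm ?_ hTS
  rw [convexHull_eq_union]
  refine Set.iUnion_subset fun t => Set.iUnion₂_subset fun hts hind => h t hts ?_
  have h1 := hind.card_le_finrank_succ
  have h2 := Submodule.finrank_le (vectorSpan ℝ (Set.range ((↑) : t → EuclideanSpace ℝ (Fin n))))
  rw [finrank_euclideanSpace_fin] at h2
  rw [Fintype.card_coe] at h1
  omega

end ConvexHull

/-! ### Support functions, separation and polars. -/

section SupportFunction

variable {A : Set (EuclideanSpace ℝ (Fin n))} {a x : EuclideanSpace ℝ (Fin n)}

theorem bddAbove_inner_image (hA : IsCompact A) (a : EuclideanSpace ℝ (Fin n)) :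
    BddAbove ((fun x => (inner ℝ a x : ℝ)) '' A) :=
  (hA.image (by fun_prop)).bddAbove

theorem inner_le_supportFun (hA : IsCompact A) (hx : x ∈ A) : inner ℝ a x ≤ supportFun A a :=
  le_csSup (bddAbove_inner_image hA a) (Set.mem_image_of_mem _ hx)

theorem supportFun_le {c : ℝ} (hA : A.Nonempty) (h : ∀ x ∈ A, inner ℝ a x ≤ c) :
    supportFun A a ≤ c :=
  csSup_le (hA.image _) (by rintro _ ⟨x, hx, rfl⟩; exact h x hx)

theorem supportFun_mono {B : Set (EuclideanSpace ℝ (Fin n))} (hA : A.Nonempty) (hB : IsCompact B)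
    (h : A ⊆ B) : supportFun A a ≤ supportFun B a :=
  supportFun_le hA fun _ hx => inner_le_supportFun hB (h hx)

theorem continuous_supportFun (hA : IsCompact A) : Continuous (supportFun A) :=
  hA.continuous_sSup (f := fun a x : EuclideanSpace ℝ (Fin n) => (inner ℝ a x : ℝ))
    (by simp only [Function.HasUncurry.uncurry, id]; fun_prop)

theorem supportFun_smul {r : ℝ} (hr : 0 ≤ r) (a : EuclideanSpace ℝ (Fin n)) :
    supportFun A (r • a) = r * supportFun A a := by
  have : (fun x => (inner ℝ (r • a) x : ℝ)) '' A = r • ((fun x => (inner ℝ a x : ℝ)) '' A) := by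
    rw [← Set.image_smul, Set.image_image]
    simp [real_inner_smul_left]
  rw [supportFun, this, Real.sSup_smul_of_nonneg hr, smul_eq_mul, supportFun]

theorem exists_supportFun_lt_inner (hA : IsClosed A) (hc : Convex ℝ A) (hne : A.Nonempty)
    (hx : x ∉ A) : ∃ a : EuclideanSpace ℝ (Fin n), supportFun A a < inner ℝ a x := by
  obtain ⟨f, u, hf, hu⟩ := geometric_hahn_banach_closed_point hc hA hx
  refine ⟨(InnerProductSpace.toDual ℝ _).symm f, ?_⟩
  have key : ∀ y, inner ℝ ((InnerProductSpace.toDual ℝ _).symm f) y = f y := fun y => by simp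
  rw [key]
  exact (supportFun_le hne fun y hy => by rw [key]; exact (hf y hy).le).trans_lt hu

theorem mem_of_forall_inner_le (hA : IsClosed A) (hc : Convex ℝ A) (hne : A.Nonempty)
    (h : ∀ a, inner ℝ a x ≤ supportFun A a) : x ∈ A := by
  by_contra hx
  obtain ⟨a, ha⟩ := exists_supportFun_lt_inner hA hc hne hx
  exact absurd (h a) ha.not_ge

theorem mem_smul_of_forall_inner_le {r : ℝ} (hr : 0 < r) (hA : IsClosed A) (hc : Convex ℝ A)
    (hne : A.Nonempty) (h : ∀ a, inner ℝ a x ≤ r * supportFun A a) : x ∈ r • A := by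
  rw [Set.mem_smul_set_iff_inv_smul_mem₀ hr.ne']
  refine mem_of_forall_inner_le hA hc hne fun a => ?_
  rw [real_inner_smul_right, inv_mul_le_iff₀ hr]
  exact h a

theorem exists_mul_norm_le_supportFun (hA : IsCompact A) (h0 : 0 ∈ interior A) :
    ∃ r > 0, ∀ a, r * ‖a‖ ≤ supportFun A a := by
  obtain ⟨r, hr, hball⟩ := Metric.nhds_basis_closedBall.mem_iff.1 (mem_interior_iff_mem_nhds.1 h0)
  refine ⟨r, hr, fun a => ?_⟩
  rcases eq_or_ne a 0 with rfl | ha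
  · simpa using inner_le_supportFun (a := 0) hA (interior_subset h0)
  have hn : ‖a‖ ≠ 0 := norm_ne_zero_iff.2 ha
  have hmem : (r * ‖a‖⁻¹) • a ∈ A := hball (by
    simp [norm_smul, abs_of_pos hr, hn])
  convert inner_le_supportFun (a := a) hA hmem using 1
  rw [real_inner_smul_right, real_inner_self_eq_norm_sq]
  field_simp

theorem supportFun_pos (hA : IsCompact A) (h0 : 0 ∈ interior A) (ha : a ≠ 0) :
    0 < supportFun A a := by
  obtain ⟨r, hr, h⟩ := exists_mul_norm_le_supportFun hA h0
  exact (mul_pos hr (norm_pos_iff.2 ha)).trans_le (h a)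

theorem exists_supportFun_le_mul_norm (hA : IsCompact A) (hne : A.Nonempty) :
    ∃ R, ∀ a, supportFun A a ≤ R * ‖a‖ := by
  obtain ⟨R, hR⟩ := hA.isBounded.exists_norm_le
  refine ⟨R, fun a => supportFun_le hne fun x hx => (real_inner_le_norm a x).trans ?_⟩
  rw [mul_comm]
  exact mul_le_mul_of_nonneg_right (hR x hx) (norm_nonneg a)

theorem eq_one_of_mem_frontier_polarBody (hA : IsCompact A) (ha : a ∈ frontier (polarBody A)) :
    supportFun A a = 1 :=
  frontier_le_subset_eq (continuous_supportFun hA) continuous_const ha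

/-- By homogeneity `r • a` leaves the polar for every `r > 1`, so `a` is not interior. -/
theorem mem_frontier_polarBody (ha : supportFun A a = 1) :
    a ∈ frontier (polarBody A) := by
  refine ⟨subset_closure ha.le, fun hi => ?_⟩
  have ht : Filter.Tendsto (fun r : ℝ => r • a) (nhdsWithin 1 (Set.Ioi 1)) (nhds a) := by
    have : Continuous fun r : ℝ => r • a := by fun_prop
    simpa using (this.tendsto 1).mono_left nhdsWithin_le_nhds
  obtain ⟨r, hr, hr1⟩ := ((ht.eventually (mem_interior_iff_mem_nhds.1 hi)).and
    self_mem_nhdsWithin).exists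
  have hr1 : 1 < r := hr1
  have hr : supportFun A (r • a) ≤ 1 := hr
  rw [supportFun_smul (by linarith), ha] at hr
  linarith

theorem mem_frontier_neg_polarBody :
    a ∈ frontier (-polarBody A) ↔ -a ∈ frontier (polarBody A) := by
  have : frontier (-polarBody A) =
      (Homeomorph.neg (EuclideanSpace ℝ (Fin n))) ⁻¹' frontier (polarBody A) := by
    rw [(Homeomorph.neg (EuclideanSpace ℝ (Fin n))).preimage_frontier]
    rfl
  rw [this]
  rfl

/-- In dimension at least two some nonzero direction has equal support values on both sides. -/
theorem exists_supportFun_eq_neg (hn : 2 ≤ n) (hA : IsCompact A) :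
    ∃ a : EuclideanSpace ℝ (Fin n), a ≠ 0 ∧ supportFun A a = supportFun A (-a) := by
  have hrank : 1 < Module.rank ℝ (EuclideanSpace ℝ (Fin n)) := by
    rw [← Module.finrank_eq_rank, finrank_euclideanSpace_fin]
    exact_mod_cast hn
  have hconn : IsPreconnected ({0}ᶜ : Set (EuclideanSpace ℝ (Fin n))) :=
    (isConnected_compl_singleton_of_one_lt_rank hrank 0).isPreconnected
  obtain ⟨b, hb⟩ : ({0}ᶜ : Set (EuclideanSpace ℝ (Fin n))).Nonempty :=
    (isConnected_compl_singleton_of_one_lt_rank hrank 0).nonempty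
  have hb : b ≠ 0 := hb
  have hcont := continuous_supportFun hA
  have hcont' : Continuous fun a => supportFun A (-a) := hcont.comp continuous_neg
  rcases le_total (supportFun A b) (supportFun A (-b)) with h | h
  · obtain ⟨a, ha, hab⟩ := hconn.intermediate_value₂ (a := b) (b := -b) hb
      (neg_ne_zero.2 hb) hcont.continuousOn hcont'.continuousOn h (by simpa using h)
    exact ⟨a, ha, hab⟩
  · obtain ⟨a, ha, hab⟩ := hconn.intermediate_value₂ (a := -b) (b := b) (neg_ne_zero.2 hb)
      hb hcont.continuousOn hcont'.continuousOn (by simpa using h) h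
    exact ⟨a, ha, hab⟩

end SupportFunction

/-! ### The maximum symmetrization, its diameter and its completeness. -/

section SymMax

variable (C : ConvexBody (EuclideanSpace ℝ (Fin n)))

theorem coe_symMax : (symMax C : Set (EuclideanSpace ℝ (Fin n))) =
    convexHull ℝ ((C : Set _) ∪ -(C : Set _)) := rfl

theorem subset_symMax : (C : Set (EuclideanSpace ℝ (Fin n))) ⊆ symMax C :=
  Set.subset_union_left.trans (subset_convexHull ℝ _)

theorem neg_subset_symMax : -(C : Set (EuclideanSpace ℝ (Fin n))) ⊆ symMax C :=
  Set.subset_union_right.trans (subset_convexHull ℝ _)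

theorem symMax_subset {A : Set (EuclideanSpace ℝ (Fin n))} (hA : Convex ℝ A)
    (h : (C : Set (EuclideanSpace ℝ (Fin n))) ⊆ A)
    (h' : -(C : Set (EuclideanSpace ℝ (Fin n))) ⊆ A) :
    (symMax C : Set (EuclideanSpace ℝ (Fin n))) ⊆ A :=
  convexHull_min (Set.union_subset h h') hA

theorem neg_symMax : -(symMax C : Set (EuclideanSpace ℝ (Fin n))) = symMax C := by
  rw [coe_symMax, ← convexHull_neg, Set.union_neg, neg_neg, Set.union_comm]

theorem supportFun_symMax (a : EuclideanSpace ℝ (Fin n)) :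
    supportFun (symMax C : Set _) a =
      max (supportFun (C : Set _) a) (supportFun (C : Set _) (-a)) := by
  apply le_antisymm
  · refine supportFun_le (symMax C).nonempty fun x hx => ?_
    refine symMax_subset C (A := {x | inner ℝ a x ≤ _}) ?_ ?_ ?_ hx
    · exact convex_halfSpace_le (innerₛₗ ℝ a).isLinear _
    · exact fun y hy => (inner_le_supportFun C.isCompact hy).trans (le_max_left _ _)
    · intro y hy
      have := inner_le_supportFun (a := -a) C.isCompact hy
      rw [inner_neg_neg] at this
      exact this.trans (le_max_right _ _)
  · refine max_le (supportFun_mono C.nonempty (symMax C).isCompact (subset_symMax C)) ?_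
    refine supportFun_le C.nonempty fun x hx => ?_
    rw [inner_neg_left, ← inner_neg_right]
    exact inner_le_supportFun (symMax C).isCompact (neg_subset_symMax C (by simpa using hx))

theorem supportFun_symMax_neg (a : EuclideanSpace ℝ (Fin n)) :
    supportFun (symMax C : Set _) (-a) = supportFun (symMax C : Set _) a := by
  rw [supportFun_symMax, supportFun_symMax, neg_neg, max_comm]

theorem zero_mem_interior_symMax
    (h0 : (0 : EuclideanSpace ℝ (Fin n)) ∈ interior (C : Set (EuclideanSpace ℝ (Fin n)))) :
    (0 : EuclideanSpace ℝ (Fin n)) ∈ interior (symMax C : Set (EuclideanSpace ℝ (Fin n))) :=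
  interior_mono (subset_symMax C) h0

theorem breadthMax_eq (A : Set (EuclideanSpace ℝ (Fin n))) (a : EuclideanSpace ℝ (Fin n)) :
    breadthMax A (C : Set _) a =
      (supportFun A a + supportFun A (-a)) / supportFun (symMax C : Set _) a := by
  rw [breadthMax, supportFun_symMax]

variable {C}

theorem bddAbove_breadthMax
    (h0 : (0 : EuclideanSpace ℝ (Fin n)) ∈ interior (C : Set (EuclideanSpace ℝ (Fin n))))
    (K : ConvexBody (EuclideanSpace ℝ (Fin n))) :
    BddAbove (breadthMax (K : Set _) (C : Set (EuclideanSpace ℝ (Fin n))) '' {s | s ≠ 0}) := by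
  obtain ⟨r, hr, hr'⟩ := exists_mul_norm_le_supportFun (symMax C).isCompact
    (zero_mem_interior_symMax C h0)
  obtain ⟨R, hR⟩ := exists_supportFun_le_mul_norm K.isCompact K.nonempty
  refine ⟨2 * R / r, ?_⟩
  rintro _ ⟨a, ha, rfl⟩
  have hn : 0 < ‖a‖ := norm_pos_iff.2 ha
  have hM := supportFun_pos (symMax C).isCompact (zero_mem_interior_symMax C h0) ha
  have h1 := hR a
  have h2 := hR (-a)
  rw [norm_neg] at h2
  have hR0 : 0 ≤ 2 * R := by
    obtain ⟨x, hx⟩ := K.nonempty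
    have h3 := inner_le_supportFun (a := a) K.isCompact hx
    have h4 := inner_le_supportFun (a := -a) K.isCompact hx
    rw [inner_neg_left] at h4
    exact nonneg_of_mul_nonneg_left (b := ‖a‖) (by linarith) hn
  rw [breadthMax_eq, div_le_div_iff₀ hM hr]
  calc _ ≤ (2 * R * ‖a‖) * r := by gcongr; linarith
    _ = 2 * R * (r * ‖a‖) := by ring
    _ ≤ _ := by gcongr; exact hr' a

theorem breadthMax_le_diamMax
    (h0 : (0 : EuclideanSpace ℝ (Fin n)) ∈ interior (C : Set (EuclideanSpace ℝ (Fin n))))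
    (K : ConvexBody (EuclideanSpace ℝ (Fin n))) {a : EuclideanSpace ℝ (Fin n)} (ha : a ≠ 0) :
    breadthMax (K : Set (EuclideanSpace ℝ (Fin n))) (C : Set (EuclideanSpace ℝ (Fin n))) a ≤
      diamMax (K : Set (EuclideanSpace ℝ (Fin n))) (C : Set (EuclideanSpace ℝ (Fin n))) :=
  le_csSup (bddAbove_breadthMax h0 K) (Set.mem_image_of_mem _ ha)

/-- With the denominator cleared, the bound needs no condition `a ≠ 0`. -/
theorem supportFun_add_neg_le
    (h0 : (0 : EuclideanSpace ℝ (Fin n)) ∈ interior (C : Set (EuclideanSpace ℝ (Fin n))))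
    (K : ConvexBody (EuclideanSpace ℝ (Fin n))) (a : EuclideanSpace ℝ (Fin n)) :
    supportFun (K : Set _) a + supportFun (K : Set _) (-a) ≤
      diamMax (K : Set (EuclideanSpace ℝ (Fin n))) (C : Set (EuclideanSpace ℝ (Fin n))) *
        supportFun (symMax C : Set _) a := by
  rcases eq_or_ne a 0 with rfl | ha
  · have h := fun A : Set (EuclideanSpace ℝ (Fin n)) =>
      supportFun_smul (A := A) le_rfl (0 : EuclideanSpace ℝ (Fin n))
    simp only [smul_zero, zero_mul] at h
    simp [h]
  · have hM := supportFun_pos (symMax C).isCompact (zero_mem_interior_symMax C h0) ha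
    rw [← div_le_iff₀ hM, ← breadthMax_eq]
    exact breadthMax_le_diamMax h0 K ha

theorem diamMax_eq_two (hn : 2 ≤ n)
    (h0 : (0 : EuclideanSpace ℝ (Fin n)) ∈ interior (C : Set (EuclideanSpace ℝ (Fin n))))
    {K : ConvexBody (EuclideanSpace ℝ (Fin n))} (hCK : (C : Set (EuclideanSpace ℝ (Fin n))) ⊆ K)
    (hKM : (K : Set (EuclideanSpace ℝ (Fin n))) ⊆ symMax C) :
    diamMax (K : Set (EuclideanSpace ℝ (Fin n))) (C : Set (EuclideanSpace ℝ (Fin n))) = 2 := by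
  obtain ⟨a, ha, hsymm⟩ := exists_supportFun_eq_neg hn C.isCompact
  apply le_antisymm
  · refine csSup_le (Set.Nonempty.image _ ⟨a, ha⟩) ?_
    rintro _ ⟨b, hb, rfl⟩
    have hM := supportFun_pos (symMax C).isCompact (zero_mem_interior_symMax C h0) hb
    rw [breadthMax_eq, div_le_iff₀ hM]
    have h1 := supportFun_mono (a := b) K.nonempty (symMax C).isCompact hKM
    have h2 := supportFun_mono (a := -b) K.nonempty (symMax C).isCompact hKM
    rw [supportFun_symMax_neg] at h2
    linarith
  · refine le_trans ?_ (breadthMax_le_diamMax h0 K ha)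
    have hM := supportFun_pos (symMax C).isCompact (zero_mem_interior_symMax C h0) ha
    rw [breadthMax_eq, le_div_iff₀ hM, supportFun_symMax, ← hsymm, max_self]
    have h1 := supportFun_mono (a := a) C.nonempty K.isCompact hCK
    have h2 := supportFun_mono (a := -a) C.nonempty K.isCompact hCK
    linarith

theorem isDiamComplete_symMax (hn : 2 ≤ n)
    (h0 : (0 : EuclideanSpace ℝ (Fin n)) ∈ interior (C : Set (EuclideanSpace ℝ (Fin n)))) :
    IsDiamComplete C (symMax C) := by
  intro K hK
  rw [diamMax_eq_two hn h0 (subset_symMax C) subset_rfl]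
  obtain ⟨x, hxK, hx⟩ := Set.exists_of_ssubset hK
  obtain ⟨a, ha⟩ := exists_supportFun_lt_inner (symMax C).isClosed (symMax C).convex
    (symMax C).nonempty hx
  have h1 := supportFun_add_neg_le h0 K a
  have h2 := inner_le_supportFun (a := a) K.isCompact hxK
  have h3 := supportFun_mono (a := -a) (symMax C).nonempty K.isCompact hK.subset
  rw [supportFun_symMax_neg] at h3
  have hM : 0 ≤ supportFun (symMax C : Set (EuclideanSpace ℝ (Fin n))) a := by
    simpa using inner_le_supportFun (a := a) (symMax C).isCompact
      (interior_subset (zero_mem_interior_symMax C h0))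
  by_contra! hle
  nlinarith

theorem isCompletion_symMax (hn : 2 ≤ n)
    (h0 : (0 : EuclideanSpace ℝ (Fin n)) ∈ interior (C : Set (EuclideanSpace ℝ (Fin n)))) :
    IsCompletion C C (symMax C) :=
  ⟨subset_symMax C, isDiamComplete_symMax hn h0, by
    rw [diamMax_eq_two hn h0 (subset_symMax C) subset_rfl,
      diamMax_eq_two hn h0 subset_rfl (subset_symMax C)]⟩

end SymMax

/-! ### The supercompletion, the outer symmetric support and polar duality. -/

section Supercompletion

variable {C : ConvexBody (EuclideanSpace ℝ (Fin n))}

theorem mem_supercompletion_iff (hn : 2 ≤ n)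
    (h0 : (0 : EuclideanSpace ℝ (Fin n)) ∈ interior (C : Set (EuclideanSpace ℝ (Fin n))))
    {x : EuclideanSpace ℝ (Fin n)} :
    x ∈ supercompletion C C ↔ ∀ a, inner ℝ a x + supportFun (C : Set _) (-a) ≤
      2 * supportFun (symMax C : Set (EuclideanSpace ℝ (Fin n))) a := by
  simp only [supercompletion, diamMax_eq_two hn h0 subset_rfl (subset_symMax C), Set.mem_iInter]
  constructor
  · intro h a
    rw [← le_sub_iff_add_le']
    refine supportFun_le C.nonempty fun y hy => ?_
    obtain ⟨_, ⟨z, hz, rfl⟩, hx⟩ := h y hy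
    have hz := inner_le_supportFun (a := a) (symMax C).isCompact hz
    rw [← hx]
    simp only [vadd_eq_add, inner_add_right, real_inner_smul_right, inner_neg_left]
    linarith
  · intro h y hy
    rw [Set.mem_vadd_set_iff_neg_vadd_mem]
    refine mem_smul_of_forall_inner_le two_pos (symMax C).isClosed (symMax C).convex
      (symMax C).nonempty fun a => ?_
    have := inner_le_supportFun (a := -a) C.isCompact hy
    rw [vadd_eq_add, inner_add_right, inner_neg_right]
    rw [inner_neg_left] at this
    linarith [h a]

theorem subset_supercompletion (hn : 2 ≤ n)
    (h0 : (0 : EuclideanSpace ℝ (Fin n)) ∈ interior (C : Set (EuclideanSpace ℝ (Fin n))))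
    {K : ConvexBody (EuclideanSpace ℝ (Fin n))} (hK : IsCompletion C C K) :
    (K : Set (EuclideanSpace ℝ (Fin n))) ⊆ supercompletion C C := by
  intro x hx
  rw [mem_supercompletion_iff hn h0]
  intro a
  have h1 := supportFun_add_neg_le h0 K a
  rw [hK.2.2, diamMax_eq_two hn h0 subset_rfl (subset_symMax C)] at h1
  have h2 := inner_le_supportFun (a := a) K.isCompact hx
  have h3 := supportFun_mono (a := -a) C.nonempty K.isCompact hK.1
  linarith

theorem supercompletion_subset_outerSupport (hn : 2 ≤ n)
    (h0 : (0 : EuclideanSpace ℝ (Fin n)) ∈ interior (C : Set (EuclideanSpace ℝ (Fin n)))) :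
    supercompletion C C ⊆ outerSupport (C : Set (EuclideanSpace ℝ (Fin n))) := by
  intro x hx
  refine Set.mem_iInter₂.2 fun a ha => ?_
  have h := (mem_supercompletion_iff hn h0).1 hx a
  have h1 := eq_one_of_mem_frontier_polarBody C.isCompact ha.1
  have h2 := eq_one_of_mem_frontier_polarBody C.isCompact (mem_frontier_neg_polarBody.1 ha.2)
  rw [supportFun_symMax, h1, h2, max_self] at h
  change inner ℝ a x ≤ 1
  linarith

theorem convex_polarBody (K : ConvexBody (EuclideanSpace ℝ (Fin n))) :
    Convex ℝ (polarBody (K : Set (EuclideanSpace ℝ (Fin n)))) := by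
  intro a ha b hb s t hs ht hst
  refine supportFun_le K.nonempty fun x hx => ?_
  have h1 := (inner_le_supportFun (a := a) K.isCompact hx).trans ha
  have h2 := (inner_le_supportFun (a := b) K.isCompact hx).trans hb
  rw [inner_add_left, real_inner_smul_left, real_inner_smul_left]
  nlinarith

theorem isCompact_polarBody {K : ConvexBody (EuclideanSpace ℝ (Fin n))}
    (h0 : (0 : EuclideanSpace ℝ (Fin n)) ∈ interior (K : Set (EuclideanSpace ℝ (Fin n)))) :
    IsCompact (polarBody (K : Set (EuclideanSpace ℝ (Fin n)))) := by
  obtain ⟨r, hr, h⟩ := exists_mul_norm_le_supportFun K.isCompact h0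
  refine Metric.isCompact_of_isClosed_isBounded
    (isClosed_le (continuous_supportFun K.isCompact) continuous_const) ?_
  refine isBounded_iff_forall_norm_le.2 ⟨1 / r, fun a ha => ?_⟩
  rw [le_div_iff₀' hr]
  exact (h a).trans ha

/-- If the supercompletion is `C_MAX`, the extreme points of the polar of `C_MAX` are directions in
which `C` supports equally on both sides. -/
theorem supportFun_neg_le_of_extreme (hn : 2 ≤ n)
    (h0 : (0 : EuclideanSpace ℝ (Fin n)) ∈ interior (C : Set (EuclideanSpace ℝ (Fin n))))
    (h : supercompletion C C ⊆ (symMax C : Set (EuclideanSpace ℝ (Fin n))))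
    {a : EuclideanSpace ℝ (Fin n)}
    (ha : a ∈ (polarBody (symMax C : Set (EuclideanSpace ℝ (Fin n)))).extremePoints ℝ) :
    2 * supportFun (symMax C : Set _) a - supportFun (C : Set _) (-a) ≤ 1 := by
  set M : Set (EuclideanSpace ℝ (Fin n)) := (symMax C : Set (EuclideanSpace ℝ (Fin n))) with hM
  let f : EuclideanSpace ℝ (Fin n) → ℝ := fun b => 2 * supportFun M b - supportFun (C : Set _) (-b)
  have hMf : ∀ b, supportFun M b ≤ f b := fun b => by
    have : supportFun (C : Set (EuclideanSpace ℝ (Fin n))) (-b) ≤ supportFun M b := by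
      rw [hM, supportFun_symMax]; exact le_max_right _ _
    simp only [f]; linarith
  have hf : Continuous f := by
    have h1 := continuous_supportFun (symMax C).isCompact
    have h2 := (continuous_supportFun C.isCompact).comp continuous_neg
    exact (h1.const_mul 2).sub h2
  have hpolar := isCompact_polarBody (zero_mem_interior_symMax C h0)
  let S : Set (EuclideanSpace ℝ (Fin n)) := {b | f b ≤ 1}
  have hSsub : S ⊆ polarBody M := fun b hb => (hMf b).trans hb
  have hS : IsCompact S := hpolar.of_isClosed_subset (isClosed_le hf continuous_const) hSsub
  have hS' : IsCompact (convexHull ℝ S) := isCompact_convexHull hS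
  have hfsmul : ∀ (r : ℝ) (b : EuclideanSpace ℝ (Fin n)), 0 ≤ r → f (r • b) = r * f b :=
      fun r b hr => by
    simp only [f]
    rw [← smul_neg, supportFun_smul hr, supportFun_smul hr]; ring
  have h0S : (0 : EuclideanSpace ℝ (Fin n)) ∈ S := by
    have := hfsmul 0 0 le_rfl
    rw [smul_zero, zero_mul] at this
    exact this.le.trans zero_le_one
  -- If `x` separates `b` from the hull with threshold `v`, then `v⁻¹ • x` lies in the
  -- supercompletion, hence in `M`, contradicting that `b` is in the polar of `M`.
  have hconv : polarBody M ⊆ convexHull ℝ S := by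
    intro b hb
    by_contra hbS
    obtain ⟨x, hx⟩ := exists_supportFun_lt_inner hS'.isClosed (convex_convexHull ℝ S)
      ⟨0, subset_convexHull ℝ S h0S⟩ hbS
    obtain ⟨v, hv, hvb⟩ := exists_between hx
    have hlt : ∀ c ∈ S, inner ℝ x c < v := fun c hc =>
      (inner_le_supportFun hS' (subset_convexHull ℝ S hc)).trans_lt hv
    have hv0 : 0 < v := by simpa using hlt 0 h0S
    have hxM : v⁻¹ • x ∈ M := h <| (mem_supercompletion_iff hn h0).2 fun c => by
      rw [← le_sub_iff_add_le, real_inner_smul_right, real_inner_comm, inv_mul_le_iff₀ hv0]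
      change inner ℝ x c ≤ v * f c
      rcases eq_or_ne c 0 with rfl | hc
      · have := hfsmul 0 0 le_rfl
        rw [smul_zero, zero_mul] at this
        simp [this]
      · have hfc : 0 < f c :=
          (supportFun_pos (symMax C).isCompact (zero_mem_interior_symMax C h0) hc).trans_le (hMf c)
        have hcS : (f c)⁻¹ • c ∈ S := by
          change f _ ≤ 1
          rw [hfsmul _ _ (inv_nonneg.2 hfc.le), inv_mul_cancel₀ hfc.ne']
        have := hlt _ hcS
        rw [real_inner_smul_right, inv_mul_lt_iff₀ hfc, mul_comm] at this
        exact this.le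
    have hb1 := (inner_le_supportFun (a := b) (symMax C).isCompact hxM).trans hb
    rw [real_inner_smul_right, real_inner_comm, inv_mul_le_iff₀ hv0, mul_one] at hb1
    exact absurd hvb hb1.not_gt
  rw [hconv.antisymm (convexHull_min hSsub (convex_polarBody (symMax C)))] at ha
  have haS : a ∈ S := extremePoints_convexHull_subset ha
  exact haS

theorem outerSupport_subset_symMax (hn : 2 ≤ n)
    (h0 : (0 : EuclideanSpace ℝ (Fin n)) ∈ interior (C : Set (EuclideanSpace ℝ (Fin n))))
    (h : supercompletion C C ⊆ (symMax C : Set (EuclideanSpace ℝ (Fin n)))) :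
    outerSupport (C : Set (EuclideanSpace ℝ (Fin n))) ⊆ symMax C := by
  intro x hx
  have h0M := zero_mem_interior_symMax C h0
  set P : Set (EuclideanSpace ℝ (Fin n)) := polarBody (symMax C : Set (EuclideanSpace ℝ (Fin n)))
    with hP
  have hPneg : (LinearEquiv.neg ℝ : EuclideanSpace ℝ (Fin n) ≃ₗ[ℝ] EuclideanSpace ℝ (Fin n)) ''
      P = P := by
    ext a
    simp [hP, polarBody, supportFun_symMax_neg]
  have hext : ∀ e ∈ P.extremePoints ℝ, inner ℝ e x ≤ 1 := by
    intro e he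
    rcases eq_or_ne e 0 with rfl | he0
    · simp
    have hm := supportFun_pos (symMax C).isCompact h0M he0
    -- If `m < 1`, then `e` lies strictly between `0` and `m⁻¹ • e`, both in `P`.
    have hm1 : supportFun (symMax C : Set (EuclideanSpace ℝ (Fin n))) e = 1 := by
      refine le_antisymm he.1 (le_of_not_gt fun hlt => he0 ?_)
      set m := supportFun (symMax C : Set (EuclideanSpace ℝ (Fin n))) e
      have h0P : (0 : EuclideanSpace ℝ (Fin n)) ∈ P :=
        supportFun_le (symMax C).nonempty fun y _ => by simp
      have hmP : m⁻¹ • e ∈ P := by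
        change supportFun _ _ ≤ 1
        rw [supportFun_smul (inv_nonneg.2 hm.le), inv_mul_cancel₀ hm.ne']
      refine (he.2 h0P hmP ⟨1 - m, m, by linarith, hm, by ring, ?_⟩).symm
      rw [smul_zero, zero_add, smul_inv_smul₀ hm.ne']
    have hne : -e ∈ P.extremePoints ℝ := by
      rw [← hPneg, ← image_extremePoints]
      exact ⟨e, he, rfl⟩
    have h1 := supportFun_neg_le_of_extreme hn h0 h he
    have h2 := supportFun_neg_le_of_extreme hn h0 h hne
    rw [supportFun_symMax_neg, neg_neg] at h2
    have h3 := supportFun_symMax C e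
    have h4 := le_max_left (supportFun (C : Set _) e) (supportFun (C : Set _) (-e))
    have h5 := le_max_right (supportFun (C : Set _) e) (supportFun (C : Set _) (-e))
    exact Set.mem_iInter₂.1 hx e ⟨mem_frontier_polarBody (by linarith),
      mem_frontier_neg_polarBody.2 (mem_frontier_polarBody (by linarith))⟩
  have hPx : P ⊆ {a | inner ℝ a x ≤ 1} := by
    rw [hP, ← closure_convexHull_extremePoints (isCompact_polarBody h0M)
      (convex_polarBody (symMax C))]
    refine closure_minimal (convexHull_min hext ?_) (isClosed_le (by fun_prop) continuous_const)
    simp only [fun a : EuclideanSpace ℝ (Fin n) => real_inner_comm x a]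
    exact convex_halfSpace_le (innerₛₗ ℝ x).isLinear _
  refine mem_of_forall_inner_le (symMax C).isClosed (symMax C).convex (symMax C).nonempty
    fun a => ?_
  rcases eq_or_ne a 0 with rfl | ha
  · simpa using inner_le_supportFun (a := 0) (symMax C).isCompact (interior_subset h0M)
  have hm := supportFun_pos (symMax C).isCompact h0M ha
  have := hPx (a := (supportFun (symMax C : Set (EuclideanSpace ℝ (Fin n))) a)⁻¹ • a) (by
    change supportFun _ _ ≤ 1
    rw [supportFun_smul (inv_nonneg.2 hm.le), inv_mul_cancel₀ hm.ne'])
  simpa [real_inner_smul_left, inv_mul_le_iff₀ hm] using this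

theorem supercompletion_subset_smul (hn : 2 ≤ n)
    (h0 : (0 : EuclideanSpace ℝ (Fin n)) ∈ interior (C : Set (EuclideanSpace ℝ (Fin n))))
    {s : ℝ} (hs : 1 ≤ s)
    (h : ∀ a, supportFun (C : Set (EuclideanSpace ℝ (Fin n))) a ≤
      s * supportFun (C : Set _) (-a)) :
    supercompletion C C ⊆ s • (C : Set (EuclideanSpace ℝ (Fin n))) := by
  intro x hx
  rw [mem_supercompletion_iff hn h0] at hx
  refine mem_smul_of_forall_inner_le (by linarith) C.isClosed C.convex C.nonempty fun a => ?_
  have h1 := hx a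
  have h2 := h a
  have h3 := h (-a)
  rw [neg_neg] at h3
  have hpos : ∀ b, 0 ≤ supportFun (C : Set (EuclideanSpace ℝ (Fin n))) b := fun b => by
    simpa using inner_le_supportFun (a := b) C.isCompact (interior_subset h0)
  rw [supportFun_symMax] at h1
  rcases le_total (supportFun (C : Set _) a) (supportFun (C : Set _) (-a)) with hle | hle
  · rw [max_eq_right hle] at h1
    linarith
  · rw [max_eq_left hle] at h1
    -- `s h(a) - (2 h(a) - h(-a)) = (s - 1)(h(a) - h(-a)) + (s h(-a) - h(a))`, with both summands
    -- nonnegative.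
    nlinarith [hpos a, hpos (-a), mul_nonneg (sub_nonneg.2 hs) (sub_nonneg.2 hle)]

end Supercompletion

/-! ### Minkowski asymmetry and circumradii. -/

section Asymmetry

theorem circumradius_le {K C : Set (EuclideanSpace ℝ (Fin n))} {ρ : ℝ} (hρ : 0 ≤ ρ)
    {t : EuclideanSpace ℝ (Fin n)} (h : K ⊆ t +ᵥ ρ • C) : circumradius K C ≤ ρ :=
  csInf_le ⟨0, fun _ hx => hx.1⟩ ⟨hρ, t, h⟩

theorem asymmetry_nonneg (C : Set (EuclideanSpace ℝ (Fin n))) : 0 ≤ asymmetry C :=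
  Real.sInf_nonneg fun _ hx => hx.1

variable {C : ConvexBody (EuclideanSpace ℝ (Fin n))}

theorem supportFun_le_asymmetry_mul (hC : IsMinkowskiCentered (C : Set (EuclideanSpace ℝ (Fin n))))
    (a : EuclideanSpace ℝ (Fin n)) :
    supportFun (C : Set (EuclideanSpace ℝ (Fin n))) a ≤
      asymmetry (C : Set (EuclideanSpace ℝ (Fin n))) * supportFun (C : Set _) (-a) := by
  refine supportFun_le C.nonempty fun x hx => ?_
  obtain ⟨y, hy, rfl⟩ := hC.1 hx
  have h := inner_le_supportFun (a := -a) C.isCompact hy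
  simp only [neg_smul, inner_neg_right, real_inner_smul_right]
  rw [inner_neg_left] at h
  nlinarith [mul_le_mul_of_nonneg_left h (asymmetry_nonneg (C : Set (EuclideanSpace ℝ (Fin n))))]

theorem one_le_asymmetry (hn : 2 ≤ n)
    (h0 : (0 : EuclideanSpace ℝ (Fin n)) ∈ interior (C : Set (EuclideanSpace ℝ (Fin n))))
    (hC : IsMinkowskiCentered (C : Set (EuclideanSpace ℝ (Fin n)))) :
    1 ≤ asymmetry (C : Set (EuclideanSpace ℝ (Fin n))) := by
  obtain ⟨a, ha, hsymm⟩ := exists_supportFun_eq_neg hn C.isCompact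
  have h := supportFun_le_asymmetry_mul hC a
  rw [← hsymm] at h
  exact le_of_mul_le_mul_right (by simpa using h) (supportFun_pos C.isCompact h0 ha)

/-- Reflecting `-C ⊆ C_MAX ⊆ t + ρ C` gives `C ⊆ -t + ρ (-C)`. The hypothesis `h` only ensures that
some `ρ` is admissible, so the infimum is not the default 0. -/
theorem asymmetry_le_circumradius_symMax {s : ℝ} (hs : 0 ≤ s)
    (h : (symMax C : Set (EuclideanSpace ℝ (Fin n))) ⊆ s • (C : Set (EuclideanSpace ℝ (Fin n)))) :
    asymmetry (C : Set (EuclideanSpace ℝ (Fin n))) ≤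
      circumradius (symMax C : Set (EuclideanSpace ℝ (Fin n))) (C : Set _) := by
  refine le_csInf ⟨s, hs, 0, by simpa using h⟩ ?_
  rintro ρ ⟨hρ, t, ht⟩
  refine circumradius_le (t := -t) hρ fun x hx => ?_
  obtain ⟨_, ⟨z, hz, rfl⟩, hx'⟩ := ht (neg_subset_symMax C (Set.neg_mem_neg.2 hx))
  refine ⟨ρ • (-z), ⟨-z, Set.neg_mem_neg.2 hz, rfl⟩, ?_⟩
  simp only [vadd_eq_add, smul_neg] at hx' ⊢
  rw [← neg_add, hx', neg_neg]

end Asymmetry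

end GaugeGeometry

/-! ### Assembly of the four claims. -/

open GaugeGeometry
theorem mainTheorem8 (n : ℕ) (hn : 2 ≤ n) (C : ConvexBody (EuclideanSpace ℝ (Fin n)))
    (h0 : (0 : EuclideanSpace ℝ (Fin n)) ∈ interior (C : Set (EuclideanSpace ℝ (Fin n))))
    (hC : IsMinkowskiCentered (C : Set (EuclideanSpace ℝ (Fin n)))) :
    (IsCompletion C C (symMax C) ∧
      circumradius (symMax C : Set (EuclideanSpace ℝ (Fin n))) C =
        asymmetry (C : Set (EuclideanSpace ℝ (Fin n))) ∧
      ∀ K : ConvexBody (EuclideanSpace ℝ (Fin n)), IsCompletion C C K →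
        circumradius (K : Set (EuclideanSpace ℝ (Fin n))) C ≤
          circumradius (symMax C : Set (EuclideanSpace ℝ (Fin n))) C) ∧
    ((symMax C : Set (EuclideanSpace ℝ (Fin n))) ⊆ supercompletion C C ∧
      supercompletion C C ⊆ outerSupport (C : Set (EuclideanSpace ℝ (Fin n)))) ∧
    ((symMax C : Set (EuclideanSpace ℝ (Fin n))) = supercompletion C C ↔
      (symMax C : Set (EuclideanSpace ℝ (Fin n))) =
        outerSupport (C : Set (EuclideanSpace ℝ (Fin n)))) ∧
    (-(symMax C : Set (EuclideanSpace ℝ (Fin n))) = symMax C ∧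
      ∀ K : ConvexBody (EuclideanSpace ℝ (Fin n)), IsCompletion C C K →
        -(K : Set (EuclideanSpace ℝ (Fin n))) = K → K = symMax C) := by
  have hsup := isCompletion_symMax hn h0
  have hs := one_le_asymmetry hn h0 hC
  have hMsup := subset_supercompletion hn h0 hsup
  have hout := supercompletion_subset_outerSupport hn h0
  have hsub := supercompletion_subset_smul hn h0 hs (supportFun_le_asymmetry_mul hC)
  have hR : circumradius (symMax C : Set (EuclideanSpace ℝ (Fin n))) C =
      asymmetry (C : Set (EuclideanSpace ℝ (Fin n))) := by
    refine le_antisymm (circumradius_le (t := 0) (by linarith) ?_)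
      (asymmetry_le_circumradius_symMax (by linarith) (hMsup.trans hsub))
    simpa using hMsup.trans hsub
  refine ⟨⟨hsup, hR, fun K hK => ?_⟩, ⟨hMsup, hout⟩, ⟨fun h => ?_, fun h => ?_⟩,
    neg_symMax C, fun K hK hneg => ?_⟩
  · rw [hR]
    refine circumradius_le (t := 0) (by linarith) ?_
    simpa using (subset_supercompletion hn h0 hK).trans hsub
  · exact (hMsup.trans hout).antisymm (outerSupport_subset_symMax hn h0 h.ge)
  · exact hMsup.antisymm (hout.trans h.ge)
  · have hle : (symMax C : Set (EuclideanSpace ℝ (Fin n))) ⊆ K :=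
      symMax_subset C K.convex hK.1 (by rw [← hneg]; exact Set.neg_subset_neg.2 hK.1)
    by_contra hne
    have hlt := isDiamComplete_symMax hn h0 K
      (hle.ssubset_of_ne fun h => hne (SetLike.coe_injective h.symm))
    rw [hK.2.2, hsup.2.2] at hlt
    exact lt_irrefl _ hlt
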